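/- Let $K$ be the number of arms and $L\ge 1$ the number of objectives, and let $\mathcal C\subseteq\mathbb R^L$ be an ordering cone, i.e. a closed convex cone containing the origin and with non-empty interior (in particular, any preference cone $\{x: Ax\ge 0\}$ with $A$ of full row rank). *Instances.* For each arm $k$ the reward vector has a law in a regular exponential family on $\mathbb R^L$: the densities $h_k(x)\exp(\eta^\top x-\psi_k(\eta))$ with respect to Lebesgue measure, where $h_k \ge 0$ is measurable and not a.e. zero, $\eta$ ranges over the natural parameters (those for which the density can be normalised), and the set of natural parameters is open. A law of the family is determined by its mean vector. Let $\mathcal M$ be the set of matrices in $\mathbb R^{L\times K}$ with entries in $[M_{\min},M_{\max}]$ whose $k$-th column is, for each $k$, the mean of a law of the $k$-th family. Let $M\in\mathcal M$ be the true instance. *Sampling.* In each round $n$ the learner chooses an arm $k_n$ as a function of the past (and possibly of internal randomisation), and then observes a reward vector $R_n$ which, conditionally on the past and $k_n$, has the law of arm $k_n$ with mean $M^{(k_n)}$ (the $k_n$-th column of $M$). After $t$ rounds let $N_{k,t}$ be the number of pulls of arm $k$, and let $\hat M_t$ be the matrix whose $k$-th column $\hat M_t^{(k)}$ is the empirical mean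 of the rewards of arm $k$. *Divergence.* For $z\in\mathcal C\setminus\{0\}$ and $\tilde M\in\mathcal M$, let $\eta$ be the natural parameter of the law of arm $k$ with mean $\tilde M^{(k)}$. The laws of the scalarised reward $z^\top R$ under the natural parameters $\eta+sz$, $s\in\mathbb R$, form a one-parameter exponential family with sufficient statistic $z^\top R$, and $d_{\mathrm{KL}}(x,z^\top\tilde M^{(k)})$ denotes the Kullback–Leibler divergence of the member with mean $x$ from the member with mean $z^\top\tilde M^{(k)}$, i.e. $s=0$ (and $+\infty$ if no member has mean $x$). *Threshold.* Let $h(u)=u-\ln u$ for $u\ge1$, with inverse $h^{-1}:[1,\infty)\to[1,\infty)$. Set $$\tilde h_z(x)=\begin{cases}\exp\!\big(1/h^{-1}(x)\big)\,h^{-1}(x)&\text{if }x\ge h^{-1}(1/\ln z),\\ z\,(x-\ln\ln z)&\text{otherwise,}\end{cases}\qquad \mathcal T(x)=2\,\tilde h_{3/2}\!\left(\frac{h^{-1}(1+x)+\ln(2\zeta(2))}{2}\right),$$ where $\zeta(2)=\sum_{n\ge1}n^{-2}$, and, for $\delta\in(0,1)$, $$\beta(t,\delta)=\sum_{k=1}^K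 3\ln\big(1+\ln N_{k,t}\big)+K\,\mathcal T\!\left(\frac{\ln(1/\delta)}{K}\right).$$ Arms with $N_{k,t}=0$ contribute $0$ to this sum and to the sum below. *Claim.* Define the confidence set $$c(t,\delta)=\Big\{\tilde M\in\mathcal M:\ \inf_{z\in\mathcal C\setminus\{0\}}\ \sum_{k=1}^K N_{k,t}\,d_{\mathrm{KL}}\big(z^\top\hat M_t^{(k)},z^\top\tilde M^{(k)}\big)\le\beta(t,\delta)\Big\}.$$ Then for every $t\in\mathbb N$ and every $\delta\in(0,1)$, $$\mathbb P\big(M\notin c(t,\delta)\big)\le\delta .$$ -/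

import Mathlib

open MeasureTheory ProbabilityTheory
open scoped ENNReal NNReal RealInnerProductSpace

noncomputable section

namespace PrePEx

/-! ### Preference cones -/

/-- An ordering cone: a closed convex cone that contains the origin and has nonempty interior. -/
structure IsOrderingCone {L : ℕ} (C : Set (EuclideanSpace ℝ (Fin L))) : Prop where
  smul_mem : ∀ v ∈ C, ∀ a : ℝ, 0 ≤ a → a • v ∈ C
  zero_mem : (0 : EuclideanSpace ℝ (Fin L)) ∈ C
  convex : Convex ℝ C
  isClosed : IsClosed C
  solid : (interior C).Nonempty

/-- The scalarised mean `zᵀ M⁽ᵏ⁾`, where `M⁽ᵏ⁾` is the `k`-th column of `M`. -/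
def scalarize {L K : ℕ} (z : EuclideanSpace ℝ (Fin L)) (M : Matrix (Fin L) (Fin K) ℝ)
    (k : Fin K) : ℝ :=
  ∑ l, z l * M l k

/-! ### Exponential families of jointly continuous reward vectors -/

section ExpFamily

variable {L : ℕ}

/-- The measure `h(x) dx` on `ℝᴸ`. -/
def refMeasure (h : EuclideanSpace ℝ (Fin L) → ℝ≥0) : Measure (EuclideanSpace ℝ (Fin L)) :=
  volume.withDensity fun x => (h x : ℝ≥0∞)

/-- The natural parameters: all `η` with `∫ h(x) exp ⟪η, x⟫ dx < ∞`. -/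
def naturalSpace (h : EuclideanSpace ℝ (Fin L) → ℝ≥0) : Set (EuclideanSpace ℝ (Fin L)) :=
  {η | Integrable (fun x => Real.exp ⟪η, x⟫) (refMeasure h)}

/-- The law with Lebesgue density `h(x) exp (⟪η, x⟫ - ψ(η))`,
where `ψ(η) = log ∫ h(x) exp ⟪η, x⟫ dx`. -/
def expLaw (h : EuclideanSpace ℝ (Fin L) → ℝ≥0) (η : EuclideanSpace ℝ (Fin L)) :
    Measure (EuclideanSpace ℝ (Fin L)) :=
  (refMeasure h).tilted fun x => ⟪η, x⟫

/-- The base density `h` generates a regular exponential family: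
`h` is measurable and not almost everywhere zero, and the set of natural parameters is open. -/
structure IsRegularExpFamily (h : EuclideanSpace ℝ (Fin L) → ℝ≥0) : Prop where
  measurable : Measurable h
  ne_zero : refMeasure h ≠ 0
  isOpen_naturalSpace : IsOpen (naturalSpace h)

/-- `ν` is the member of the exponential family generated by `h` with mean vector `m`. -/
def IsMember (h : EuclideanSpace ℝ (Fin L) → ℝ≥0) (ν : Measure (EuclideanSpace ℝ (Fin L)))
    (m : Fin L → ℝ) : Prop :=
  ∃ η ∈ naturalSpace h, ν = expLaw h η ∧ ∀ l, ∫ x, x l ∂ν = m l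

/-- The divergence `d_KL(x, zᵀ m)` of the scalarised reward `zᵀ R` of an arm whose reward vector
`R` has mean `m`, at a scalar mean `x`.

If `η` is the natural parameter of the law with mean `m`, then the laws of `zᵀ R` under the natural
parameters `η + s z`, `s ∈ ℝ`, form the one-parameter exponential family with sufficient statistic
`zᵀ R` through the law of `zᵀ R` under `η`. The divergence is the Kullback-Leibler divergence of
the member of mean `x` of this family from the member of mean `zᵀ m` (the law under `η`).
For `z ≠ 0` there is at most one admissible `η` and one admissible `s`, so that the infimum only
selects them; it is `∞` if there is no member of mean `x`. -/
def scalarKL (h : EuclideanSpace ℝ (Fin L) → ℝ≥0) (z : EuclideanSpace ℝ (Fin L))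
    (x : ℝ) (m : Fin L → ℝ) : ℝ≥0∞ :=
  ⨅ (η : EuclideanSpace ℝ (Fin L)) (s : ℝ)
    (_ : η ∈ naturalSpace h ∧ (∀ l, ∫ y, y l ∂(expLaw h η) = m l))
    (_ : η + s • z ∈ naturalSpace h ∧ ∫ y, ⟪z, y⟫ ∂(expLaw h (η + s • z)) = x),
    InformationTheory.klDiv ((expLaw h (η + s • z)).map fun y => ⟪z, y⟫)
      ((expLaw h η).map fun y => ⟪z, y⟫)

/-- The class `𝓜` of instances: the matrices with entries in `[Mmin, Mmax]` such that for each arm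
`k` the `k`-th column is the mean vector of a member of the exponential family of arm `k`. -/
def instanceClass {K : ℕ} (h : Fin K → EuclideanSpace ℝ (Fin L) → ℝ≥0) (Mmin Mmax : ℝ) :
    Set (Matrix (Fin L) (Fin K) ℝ) :=
  {M | (∀ l k, M l k ∈ Set.Icc Mmin Mmax) ∧ ∀ k, ∃ ν, IsMember (h k) ν fun l => M l k}

end ExpFamily

/-! ### Adaptive sampling -/

section Sampling

variable {Ω : Type*} {L K : ℕ}

/-- In round `n` an arm `A n` is chosen from the information `ℱ n` of the past (which may contain
internal randomisation), and then a reward vector `R n` is drawn from the law `ν (A n)`. -/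
structure IsBanditProcess {mΩ : MeasurableSpace Ω} (P : Measure Ω) (ℱ : Filtration ℕ mΩ)
    (ν : Fin K → Measure (EuclideanSpace ℝ (Fin L)))
    (A : ℕ → Ω → Fin K) (R : ℕ → Ω → EuclideanSpace ℝ (Fin L)) : Prop where
  measurable_arm : ∀ n, Measurable[ℱ n] (A n)
  measurable_reward : ∀ n, Measurable[ℱ (n + 1)] (R n)
  condLaw : ∀ n, ∀ B : Set (EuclideanSpace ℝ (Fin L)), MeasurableSet B →
    P[(R n ⁻¹' B).indicator (fun _ => (1 : ℝ)) | ℱ n] =ᵐ[P] fun ω => (ν (A n ω)).real B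

/-- `N_{k,t}`: the number of pulls of arm `k` in the first `t` rounds. -/
def pulls (A : ℕ → Ω → Fin K) (t : ℕ) (ω : Ω) (k : Fin K) : ℕ :=
  ((Finset.range t).filter fun n => A n ω = k).card

/-- `M̂_t`: the matrix whose `k`-th column is the empirical mean of the rewards of arm `k` in the
first `t` rounds. -/
def empMean (A : ℕ → Ω → Fin K) (R : ℕ → Ω → EuclideanSpace ℝ (Fin L)) (t : ℕ) (ω : Ω) :
    Matrix (Fin L) (Fin K) ℝ :=
  fun l k => (∑ n ∈ (Finset.range t).filter (fun n => A n ω = k), R n ω l) / (pulls A t ω k : ℝ)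

end Sampling

/-! ### The threshold -/

/-- The inverse of the bijection `h : [1, ∞) → [1, ∞)`, `h(u) = u - log u`. -/
def hInv (x : ℝ) : ℝ :=
  Function.invFunOn (fun u : ℝ => u - Real.log u) (Set.Ici 1) x

/-- The function `h̃_z`. -/
def hTilde (z x : ℝ) : ℝ :=
  open Classical in
  if hInv (1 / Real.log z) ≤ x then Real.exp (1 / hInv x) * hInv x
  else z * (x - Real.log (Real.log z))

/-- The function `𝒯`, with `ζ(2) = ∑_{n ≥ 1} n⁻²`. -/
def calT (x : ℝ) : ℝ :=
  2 * hTilde (3 / 2) ((hInv (1 + x) + Real.log (2 * ∑' n : ℕ, 1 / ((n : ℝ) + 1) ^ 2)) / 2)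

/-- The threshold `β(t, δ)` as a function of the numbers of pulls `N_{k,t}`. For an arm that was
never pulled the logarithmic term is `0`. -/
def threshold {K : ℕ} (N : Fin K → ℕ) (δ : ℝ) : ℝ :=
  ∑ k, 3 * Real.log (1 + Real.log (N k)) + K * calT (Real.log (1 / δ) / K)

/-! ### The confidence set -/

/-- The confidence set `c(t, δ)`: the instances `M' ∈ 𝓜` with
`inf_{z ∈ C, z ≠ 0} ∑ₖ N_{k,t} d_KL(zᵀ M̂_t⁽ᵏ⁾, zᵀ M'⁽ᵏ⁾) ≤ β(t, δ)`. -/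
def confSet {Ω : Type*} {L K : ℕ} (C : Set (EuclideanSpace ℝ (Fin L)))
    (h : Fin K → EuclideanSpace ℝ (Fin L) → ℝ≥0) (Mmin Mmax : ℝ)
    (A : ℕ → Ω → Fin K) (R : ℕ → Ω → EuclideanSpace ℝ (Fin L))
    (t : ℕ) (δ : ℝ) (ω : Ω) : Set (Matrix (Fin L) (Fin K) ℝ) :=
  {M' ∈ instanceClass h Mmin Mmax |
    ⨅ z ∈ C \ {0}, ∑ k, (pulls A t ω k : ℝ≥0∞) *
        scalarKL (h k) z (scalarize z (empMean A R t ω) k) (fun l => M' l k)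
      ≤ ENNReal.ofReal (threshold (pulls A t ω) δ)}

end PrePEx

end

/-! A single direction suffices: the infimum over z is at most its value at one fixed nonzero z in
C, so if M lies outside the confidence set, the divergence sum for that z exceeds the threshold.
Along z each arm is a one-parameter exponential family with log-partition function φ (`cgf`), and
the divergence of its member s is at most `divAt` = s φ'(s) - φ(s).

The deviation bound is the method of mixtures. For each arm, `exists_mixture` builds a probability
measure on natural parameters, independent of the data, whose mixed likelihood ratio is at least (1
- l) exp(l max(0, Y)), where Y is N times the divergence, corrected for the unknown sample size.
Products of likelihood ratios have mean one under adaptive sampling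
(`IsBanditProcess.lintegral_prod_eq_one`), hence so do products of mixtures
(`lintegral_prod_mixture_eq_one`). A divergence sum above the threshold forces ∑ max(0, Y) ≥ K y
with y = `hInv (1 + log (1/δ) / K)` (`mul_hInv_le_sum_of_threshold_lt`). For l = 1 - 1/y the product
of mixtures is then at least 1/δ, and Markov's inequality at the fixed time t concludes.

The divergence is ∞ when no member has the empirical mean. `exists_deriv_cgf_eq` rules this out
almost surely, because the reward laws have densities and the natural parameter sets are open. -/

namespace PrePEx

/-! ### The threshold functions -/

/-- `hInv` is a right inverse of `u ↦ u - log u` with values in `[1, ∞)`. -/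
lemma hInv_spec {x : ℝ} (hx : 1 ≤ x) : 1 ≤ hInv x ∧ hInv x - Real.log (hInv x) = x := by
  have hex : ∃ u ∈ Set.Ici (1 : ℝ), (fun u : ℝ => u - Real.log u) u = x := by
    -- The right endpoint `2 * x` overshoots because log (2x) ≤ log 2 + x - 1 < x.
    have hcont : ContinuousOn (fun u : ℝ => u - Real.log u) (Set.Icc 1 (2 * x)) :=
      continuousOn_id.sub (Real.continuousOn_log.mono fun u hu => by
        have := hu.1
        simp only [Set.mem_compl_iff, Set.mem_singleton_iff]
        linarith)
    have hmem : x ∈ Set.Icc ((fun u : ℝ => u - Real.log u) 1)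
        ((fun u : ℝ => u - Real.log u) (2 * x)) := by
      refine ⟨by simpa using hx, ?_⟩
      have h1 : Real.log (2 * x) = Real.log 2 + Real.log x :=
        Real.log_mul (by norm_num) (by linarith)
      have h2 := Real.log_le_sub_one_of_pos (show (0 : ℝ) < x by linarith)
      have h3 := Real.log_two_lt_d9
      simp only [h1]
      linarith
    obtain ⟨u, hu, hux⟩ := intermediate_value_Icc (by linarith) hcont hmem
    exact ⟨u, hu.1, hux⟩
  exact ⟨Function.invFunOn_mem hex, Function.invFunOn_eq hex⟩

lemma le_hInv {x : ℝ} (hx : 1 ≤ x) : x ≤ hInv x := by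
  obtain ⟨h1, h2⟩ := hInv_spec hx
  linarith [Real.log_nonneg h1]

lemma one_lt_hInv {x : ℝ} (hx : 1 < x) : 1 < hInv x := hx.trans_le (le_hInv hx.le)

lemma log_three_halves : 0 < Real.log (3 / 2) ∧ Real.log (3 / 2) ≤ 1 / 2 := by
  refine ⟨Real.log_pos (by norm_num), ?_⟩
  have := Real.log_le_sub_one_of_pos (show (0 : ℝ) < 3 / 2 by norm_num)
  linarith

/-- `h̃_{3/2}` dominates one of the affine functions `x ↦ b (x - log log b)`, `1 < b ≤ 3/2`. -/
lemma exists_affine_le_hTilde (x : ℝ) :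
    ∃ b : ℝ, 1 < b ∧ b ≤ 3 / 2 ∧ b * (x - Real.log (Real.log b)) ≤ hTilde (3 / 2) x := by
  obtain ⟨hl0, hl1⟩ := log_three_halves
  unfold hTilde
  split_ifs with hx
  · have hr : (1 : ℝ) ≤ 1 / Real.log (3 / 2) := by
      rw [le_div_iff₀ hl0]; linarith
    -- The case condition enters only through x ≥ 1 / log (3/2), which makes the minimiser below at
    -- most 3/2.
    have hrx : 1 / Real.log (3 / 2) ≤ x := (le_hInv hr).trans hx
    obtain ⟨hu1, hu2⟩ := hInv_spec (hr.trans hrx)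
    have hru : 1 / Real.log (3 / 2) ≤ hInv x := hrx.trans (le_hInv (hr.trans hrx))
    have hu0 : 0 < hInv x := by linarith
    -- With u = 1 / log b, stationarity of b ↦ b (x - log log b) reads u - log u = x, so u = `hInv
    -- x`, and the value there is b u.
    refine ⟨Real.exp (1 / hInv x), ?_, ?_, ?_⟩
    · rw [Real.one_lt_exp_iff]; positivity
    · rw [← Real.le_log_iff_exp_le (by norm_num)]
      rw [div_le_iff₀ hl0] at hru
      rw [div_le_iff₀ hu0]
      linarith
    · rw [Real.log_exp, one_div, Real.log_inv]
      refine le_of_eq ?_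
      congr 1
      linarith
  · exact ⟨3 / 2, by norm_num, le_rfl, le_rfl⟩

/-- The series defining `ζ(2)` converges. -/
lemma zetaTwo_summable : Summable fun n : ℕ => 1 / ((n : ℝ) + 1) ^ 2 := by
  have := (summable_nat_add_iff 1).mpr (Real.summable_one_div_nat_pow.mpr (by norm_num : 1 < 2))
  simpa using this

lemma one_le_zetaTwo : 1 ≤ ∑' n : ℕ, 1 / ((n : ℝ) + 1) ^ 2 := by
  have := zetaTwo_summable.le_tsum 0 (fun j _ => by positivity)
  simpa using this

end PrePEx

/-! ### Divergence in the natural parameter and measurable selectors -/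

namespace PrePEx

section Cgf

variable {E : Type*} [MeasurableSpace E] {ν : Measure E} {X : E → ℝ}

/-- The divergence, as a function of the natural parameter, between the member `s` of the
exponential family generated by `X` under `ν` and `ν`. -/
noncomputable def divAt (X : E → ℝ) (ν : Measure E) (s : ℝ) : ℝ :=
  s * deriv (cgf X ν) s - cgf X ν s

lemma measurable_cgf [SFinite ν] (hX : Measurable X) : Measurable (cgf X ν) := by
  have : StronglyMeasurable fun p : ℝ × E => Real.exp (p.1 * X p.2) := by
    apply Measurable.stronglyMeasurable
    fun_prop
  exact (this.integral_prod_right').measurable.log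

lemma zero_mem_integrableExpSet [IsFiniteMeasure ν] : (0 : ℝ) ∈ integrableExpSet X ν := by
  simp [integrableExpSet]

/-- The second derivative of the log-partition function is the variance of the tilted law. -/
lemma monotoneOn_deriv_cgf (hΘ : IsOpen (integrableExpSet X ν)) :
    MonotoneOn (deriv (cgf X ν)) (integrableExpSet X ν) := by
  have hint : interior (integrableExpSet X ν) = integrableExpSet X ν := hΘ.interior_eq
  have han : AnalyticOnNhd ℝ (deriv (cgf X ν)) (integrableExpSet X ν) := by
    have := analyticOnNhd_cgf (X := X) (μ := ν)
    rw [hint] at this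
    exact this.deriv
  refine monotoneOn_of_deriv_nonneg convex_integrableExpSet han.continuousOn ?_ ?_
  · rw [hint]; exact han.differentiableOn
  · intro s hs
    have h2 := variance_tilted_mul hs
    rw [iteratedDeriv_succ, iteratedDeriv_one] at h2
    rw [← h2]
    exact variance_nonneg _ _

lemma continuousOn_divAt (hΘ : IsOpen (integrableExpSet X ν)) :
    ContinuousOn (divAt X ν) (integrableExpSet X ν) := by
  have han := analyticOnNhd_cgf (X := X) (μ := ν)
  rw [hΘ.interior_eq] at han
  exact (continuousOn_id.mul han.deriv.continuousOn).sub han.continuousOn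

/-- A measurable choice of a nonnegative natural parameter for every level of the divergence. -/
lemma exists_measurable_selector [IsFiniteMeasure ν]
    (hΘ : IsOpen (integrableExpSet X ν)) :
    ∃ σ : ℝ → ℝ, Measurable σ ∧ (∀ y, σ y ∈ integrableExpSet X ν) ∧
      ∀ y, ∀ s ∈ integrableExpSet X ν, 0 ≤ s → y ≤ divAt X ν s →
        y ≤ σ y * deriv (cgf X ν) s - cgf X ν (σ y) := by
  classical
  -- `T y` shrinks as y grows, so measurability of its infimum follows from order alone.
  set T : ℝ → Set ℝ := fun y => {s | 0 ≤ s ∧ s ∈ integrableExpSet X ν ∧ y ≤ divAt X ν s} with hT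
  have hanti : ∀ {y y'}, y' ≤ y → T y ⊆ T y' := fun h s hs => ⟨hs.1, hs.2.1, h.trans hs.2.2⟩
  have hleast : ∀ y, (T y).Nonempty → IsLeast (T y) (sInf (T y)) := by
    rintro y ⟨s, hs0, hsΘ, hsy⟩
    have hsub : Set.Icc 0 s ⊆ integrableExpSet X ν :=
      (convex_integrableExpSet (X := X) (μ := ν)).ordConnected.out zero_mem_integrableExpSet hsΘ
    have hcl : IsCompact (Set.Icc 0 s ∩ divAt X ν ⁻¹' Set.Ici y) :=
      isCompact_Icc.of_isClosed_subset (((continuousOn_divAt hΘ).mono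
        hsub).preimage_isClosed_of_isClosed isClosed_Icc isClosed_Ici) Set.inter_subset_left
    obtain ⟨a, ⟨⟨ha0, has⟩, hay⟩, hamin⟩ := hcl.exists_isLeast ⟨s, ⟨hs0, le_rfl⟩, hsy⟩
    have hl : IsLeast (T y) a := by
      refine ⟨⟨ha0, hsub ⟨ha0, has⟩, hay⟩, fun u hu => ?_⟩
      rcases le_total u s with h | h
      · exact hamin ⟨⟨hu.1, h⟩, hu.2.2⟩
      · exact has.trans h
    rwa [hl.csInf_eq]
  refine ⟨fun y => if (T y).Nonempty then sInf (T y) else 0, ?_, ?_, ?_⟩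
  · have hN : MeasurableSet {y | (T y).Nonempty} :=
      Set.OrdConnected.measurableSet
        (IsLowerSet.ordConnected fun y y' h hy => hy.mono (hanti h))
    refine measurable_of_Iic fun a => ?_
    have hA : MeasurableSet {y | (T y).Nonempty ∧ sInf (T y) ≤ a} :=
      Set.OrdConnected.measurableSet (IsLowerSet.ordConnected fun y y' h hy =>
        ⟨hy.1.mono (hanti h),
          (csInf_le_csInf ⟨0, fun s hs => hs.1⟩ hy.1 (hanti h)).trans hy.2⟩)
    have : (fun y => if (T y).Nonempty then sInf (T y) else 0) ⁻¹' Set.Iic a =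
        {y | (T y).Nonempty ∧ sInf (T y) ≤ a} ∪ ({y | (T y).Nonempty}ᶜ ∩ {_y | 0 ≤ a}) := by
      ext y
      by_cases h : (T y).Nonempty <;> simp [h]
    rw [this]
    exact hA.union (hN.compl.inter (MeasurableSet.const _))
  · intro y
    dsimp only
    split_ifs with h
    · exact (hleast y h).1.2.1
    · exact zero_mem_integrableExpSet
  · intro y s hsΘ hs0 hy
    have hne : (T y).Nonempty := ⟨s, hs0, hsΘ, hy⟩
    simp only [if_pos hne]
    obtain ⟨⟨h0, h1, h2⟩, h3⟩ := hleast y hne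
    -- The selected σ lies in [0, s], so σ φ'(σ) ≤ σ φ'(s): one selector serves every s beyond it.
    have hm := monotoneOn_deriv_cgf hΘ h1 hsΘ (h3 ⟨hs0, hsΘ, hy⟩)
    have := mul_le_mul_of_nonneg_left hm h0
    unfold divAt at h2
    linarith

lemma integrableExpSet_neg : integrableExpSet (fun x => -X x) ν = -integrableExpSet X ν := by
  ext s
  simp [integrableExpSet]

lemma cgf_neg_fun (s : ℝ) : cgf (fun x => -X x) ν s = cgf X ν (-s) := by
  simp [cgf, mgf]

lemma deriv_cgf_neg_fun (s : ℝ) :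
    deriv (cgf (fun x => -X x) ν) s = -deriv (cgf X ν) (-s) := by
  rw [show cgf (fun x => -X x) ν = fun s => cgf X ν (-s) from funext cgf_neg_fun,
    deriv_comp_neg]

/-- Two measurable families of natural parameters, one of which witnesses a lower bound on the
divergence. -/
lemma exists_measurable_selectors [IsFiniteMeasure ν] (hΘ : IsOpen (integrableExpSet X ν)) :
    ∃ σ : Bool → ℝ → ℝ, (∀ b, Measurable (σ b)) ∧ (∀ b y, σ b y ∈ integrableExpSet X ν) ∧
      ∀ s ∈ integrableExpSet X ν, ∃ b, ∀ y, y ≤ divAt X ν s →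
        y ≤ σ b y * deriv (cgf X ν) s - cgf X ν (σ b y) := by
  obtain ⟨σ, hσ, hσΘ, h⟩ := exists_measurable_selector hΘ
  have hΘ' : IsOpen (integrableExpSet (fun x => -X x) ν) := by
    rw [integrableExpSet_neg]; exact hΘ.neg
  obtain ⟨τ, hτ, hτΘ, h'⟩ := exists_measurable_selector hΘ'
  simp only [integrableExpSet_neg, Set.mem_neg, cgf_neg_fun, deriv_cgf_neg_fun, divAt] at hτΘ h'
  -- `true` serves s ≥ 0 and `false` serves s ≤ 0, by reflection; the choice depends on s but not on
  -- the level y.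
  refine ⟨fun b => if b then σ else fun y => -τ y, ?_, ?_, ?_⟩
  · intro b; cases b
    · simpa using hτ
    · simpa using hσ
  · intro b y; cases b
    · simpa using hτΘ y
    · simpa using hσΘ y
  · intro s hs
    rcases le_total 0 s with h0 | h0
    · exact ⟨true, fun y hy => by simpa using h y s hs h0 hy⟩
    · refine ⟨false, fun y hy => ?_⟩
      have := h' y (-s) (by simpa using hs) (by simpa using h0) (by simpa [divAt] using hy)
      simpa using this

end Cgf

end PrePEx

/-! ### Construction of the mixture for one arm -/

namespace PrePEx

section Mixture

variable {E : Type*} [MeasurableSpace E] {ν : Measure E} {X : E → ℝ}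

/-- Integrating `exp` against an exponential law of rate `1 - l` up to level `Y`. -/
lemma ofReal_le_lintegral_expMeasure {l Y : ℝ} (hl0 : 0 < l) (hl1 : l < 1) (hY : 0 ≤ Y)
    {f : ℝ → ℝ≥0∞} {p : ℝ} (hp : 0 < p) (hf : Measurable f)
    (h : ∀ y ∈ Set.Icc 0 Y, ENNReal.ofReal (Real.exp y / p) ≤ f y) :
    ENNReal.ofReal ((1 - l) * (Real.exp (l * Y) - 1)) ≤
      ENNReal.ofReal (l * p) * ∫⁻ y, f y ∂(expMeasure (1 - l)) := by
  have h1 : ∀ y ∈ Set.Icc 0 Y, ENNReal.ofReal ((1 - l) / p * Real.exp (l * y)) ≤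
      exponentialPDF (1 - l) y * f y := by
    intro y hy
    refine le_trans ?_ (mul_le_mul_right (h y hy) _)
    rw [exponentialPDF_of_nonneg hy.1, ← ENNReal.ofReal_mul (mul_nonneg (by linarith) (by positivity))]
    refine ENNReal.ofReal_le_ofReal (le_of_eq ?_)
    rw [show l * y = -((1 - l) * y) + y by ring, Real.exp_add]
    ring
  have hint : ∫ y in (0 : ℝ)..Y, (1 - l) / p * Real.exp (l * y) =
      (1 - l) / p * ((Real.exp (l * Y) - 1) / l) := by
    rw [intervalIntegral.integral_const_mul,
      intervalIntegral.integral_comp_mul_left (fun x => Real.exp x) hl0.ne', integral_exp]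
    simp [div_eq_inv_mul]
  have h2 : ENNReal.ofReal ((1 - l) / p * ((Real.exp (l * Y) - 1) / l)) ≤
      ∫⁻ y, f y ∂(expMeasure (1 - l)) := by
    have hd : expMeasure (1 - l) = volume.withDensity (exponentialPDF (1 - l)) := rfl
    have hm : Measurable (exponentialPDF (1 - l)) :=
      (measurable_exponentialPDFReal _).ennreal_ofReal
    rw [hd, lintegral_withDensity_eq_lintegral_mul _ hm hf, ← hint,
      intervalIntegral.integral_of_le hY, ofReal_integral_eq_lintegral_ofReal]
    · refine le_trans ?_ (setLIntegral_le_lintegral (Set.Ioc 0 Y) _)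
      exact setLIntegral_mono' measurableSet_Ioc fun y hy => h1 y (Set.Ioc_subset_Icc_self hy)
    · exact (Continuous.integrableOn_Icc (by fun_prop)).mono_set Set.Ioc_subset_Icc_self
    · exact Filter.Eventually.of_forall fun y => by
        have : 0 < 1 - l := by linarith
        positivity
  refine le_trans (le_of_eq ?_) (mul_le_mul_right h2 _)
  rw [← ENNReal.ofReal_mul (by positivity)]
  congr 1
  field_simp

/-- Every positive integer lies in a geometric slice `[b ^ j, b ^ (j + 1))`, whose index is
controlled by its logarithm. -/
lemma exists_geometric_slice {b : ℝ} (hb1 : 1 < b) (hb2 : b ≤ 3 / 2) {n : ℕ} (hn : 1 ≤ n) :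
    ∃ j : ℕ, b ^ j ≤ n ∧ (n : ℝ) ≤ b ^ (j + 1) ∧
      Real.log (j + 1) ≤ Real.log (1 + Real.log n) - Real.log (Real.log b) := by
  have hn' : (1 : ℝ) ≤ n := by exact_mod_cast hn
  obtain ⟨j, hj1, hj2⟩ := exists_nat_pow_near hn' hb1
  refine ⟨j, hj1, hj2.le, ?_⟩
  have hlb : 0 < Real.log b := Real.log_pos hb1
  have hlb1 : Real.log b ≤ 1 := by
    have := Real.log_le_sub_one_of_pos (show 0 < b by linarith)
    linarith
  have hln : 0 ≤ Real.log n := Real.log_nonneg hn'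
  rw [← Real.log_div (by linarith) hlb.ne']
  refine Real.log_le_log (by positivity) ?_
  rw [le_div_iff₀ hlb]
  have := Real.log_le_log (by positivity) hj1
  rw [Real.log_pow] at this
  linarith

/-- The mixture over natural parameters: a single probability measure on the natural parameters
whose mixture of likelihood ratios dominates, simultaneously for all sample sizes `n` and all
empirical means, an exponential of the calibrated divergence. -/
lemma exists_mixture [IsFiniteMeasure ν] (hX : Measurable X) (h1 : cgf X ν 0 = 0)
    (hΘ : IsOpen (integrableExpSet X ν)) {l b : ℝ} (hl0 : 0 < l) (hl1 : l < 1)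
    (hb1 : 1 < b) (hb2 : b ≤ 3 / 2) :
    ∃ π : Measure ℝ, IsProbabilityMeasure π ∧ (∀ᵐ s ∂π, s ∈ integrableExpSet X ν) ∧
      ∀ n : ℕ, ∀ s' ∈ integrableExpSet X ν,
        ENNReal.ofReal ((1 - l) * Real.exp (l * max 0
          ((n * divAt X ν s' - 3 * Real.log (1 + Real.log n)) / b
            - Real.log (2 * ∑' n : ℕ, 1 / ((n : ℝ) + 1) ^ 2) + 2 * Real.log (Real.log b)))) ≤
        ∫⁻ s, ENNReal.ofReal (Real.exp (n * (s * deriv (cgf X ν) s' - cgf X ν s))) ∂π := by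
  obtain ⟨σ, hσm, hσΘ, hσ⟩ := exists_measurable_selectors hΘ
  set ζ := ∑' n : ℕ, 1 / ((n : ℝ) + 1) ^ 2 with hζ
  have hζ1 : 1 ≤ ζ := one_le_zetaTwo
  have hζ0 : 0 < ζ := by linarith
  set c := Real.log (2 * ζ) with hc
  have hc0 : 0 ≤ c := Real.log_nonneg (by linarith)
  have hl1' : 0 < 1 - l := by linarith
  have := isProbabilityMeasure_expMeasure hl1'
  -- Prior weights of the slices; the factor 1/2 pays for the two signs of the parameter.
  let p : ℕ → ℝ := fun j => 1 / (2 * ζ * ((j : ℝ) + 1) ^ 2)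
  have hp : ∀ j, 0 < p j := fun j => by positivity
  -- Chosen so that b ^ j * v j y = y + log (1 / p j): on slice j the likelihood ratio is then at
  -- least e^y / p j.
  let v : ℕ → ℝ → ℝ := fun j y => (y + c + 2 * Real.log ((j : ℝ) + 1)) / b ^ j
  have hv : ∀ j, Measurable (v j) := fun j => by fun_prop
  have hs : ∀ β j, Measurable fun y => σ β (v j y) := fun β j => (hσm β).comp (hv j)
  let κ : ℕ → Bool → Measure ℝ := fun j β => (expMeasure (1 - l)).map fun y => σ β (v j y)
  have hκ : ∀ j β, IsProbabilityMeasure (κ j β) := fun j β =>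
    Measure.isProbabilityMeasure_map (hs β j).aemeasurable
  -- The atom at 0 has likelihood ratio 1. It handles Y ≤ 0, and for Y > 0 it completes (1 -
  -- l)(e^{lY} - 1) to (1 - l) e^{lY}.
  let π : Measure ℝ := ENNReal.ofReal (1 - l) • Measure.dirac 0 +
    Measure.sum fun j => ENNReal.ofReal (l * p j) • (κ j true + κ j false)
  have hsum : ∑' j, ENNReal.ofReal (l * p j) * 2 = ENNReal.ofReal l := by
    have h2 : ∀ j, ENNReal.ofReal (l * p j) * 2 =
        ENNReal.ofReal (l / ζ * (1 / ((j : ℝ) + 1) ^ 2)) := by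
      intro j
      rw [show (2 : ℝ≥0∞) = ENNReal.ofReal 2 by simp, ← ENNReal.ofReal_mul (by have := hp j; positivity)]
      congr 1
      simp only [p]
      field_simp
    simp_rw [h2]
    rw [← ENNReal.ofReal_tsum_of_nonneg (fun j => by positivity) (zetaTwo_summable.mul_left _),
      tsum_mul_left, ← hζ]
    congr 1
    field_simp
  have hlint : ∀ f : ℝ → ℝ≥0∞, ∫⁻ s, f s ∂π = ENNReal.ofReal (1 - l) * f 0 +
      ∑' j, ENNReal.ofReal (l * p j) * (∫⁻ s, f s ∂(κ j true) + ∫⁻ s, f s ∂(κ j false)) := by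
    intro f
    simp only [π, lintegral_add_measure, lintegral_sum_measure, lintegral_smul_measure,
      lintegral_dirac, smul_eq_mul]
  refine ⟨π, ⟨?_⟩, ?_, ?_⟩
  · have := hlint 1
    simp only [Pi.one_apply, lintegral_one, measure_univ, mul_one, one_add_one_eq_two] at this
    rw [this, hsum, ← ENNReal.ofReal_add hl1'.le hl0.le]
    simp
  · have hΘm : MeasurableSet (integrableExpSet X ν)ᶜ := hΘ.measurableSet.compl
    have hκ0 : ∀ j β, κ j β (integrableExpSet X ν)ᶜ = 0 := by
      intro j β
      rw [Measure.map_apply (hs β j) hΘm]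
      rw [show (fun y => σ β (v j y)) ⁻¹' (integrableExpSet X ν)ᶜ = ∅ by ext y; simp [hσΘ],
        measure_empty]
    rw [ae_iff]
    change π (integrableExpSet X ν)ᶜ = 0
    simp only [π, Measure.add_apply, Measure.smul_apply, Measure.sum_apply _ hΘm, hκ0,
      Measure.dirac_apply' _ hΘm]
    simp [zero_mem_integrableExpSet]
  · intro n s' hs'
    have hbase : ENNReal.ofReal (1 - l) * ENNReal.ofReal (Real.exp
        (n * ((0 : ℝ) * deriv (cgf X ν) s' - cgf X ν 0))) = ENNReal.ofReal (1 - l) := by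
      simp [h1]
    set Y := (n * divAt X ν s' - 3 * Real.log (1 + Real.log n)) / b - c
      + 2 * Real.log (Real.log b) with hY
    rw [hlint, hbase]
    rcases le_or_gt Y 0 with hY0 | hY0
    · rw [max_eq_left hY0]
      simp
    rw [max_eq_right hY0.le]
    have hlb : 0 < Real.log b := Real.log_pos hb1
    have hllb : Real.log (Real.log b) ≤ 0 := by
      refine Real.log_nonpos hlb.le ?_
      have := Real.log_le_sub_one_of_pos (show 0 < b by linarith)
      linarith
    -- For n = 0 the convention log 0 = 0 leaves Y = -c + 2 log log b ≤ 0.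
    have hn : 1 ≤ n := by
      by_contra hn
      have hn0 : n = 0 := by omega
      rw [hY, hn0] at hY0
      simp at hY0
      linarith
    have hn' : (1 : ℝ) ≤ n := by exact_mod_cast hn
    obtain ⟨j, hj1, hj2, hj3⟩ := exists_geometric_slice hb1 hb2 hn
    obtain ⟨β, hβ⟩ := hσ s' hs'
    have hb0 : 0 < b := by linarith
    have hbj : 0 < b ^ j := by positivity
    have hlev : ∀ y ≤ Y, v j y ≤ divAt X ν s' := by
      intro y hy
      have hln : 0 ≤ Real.log (1 + Real.log n) :=
        Real.log_nonneg (by linarith [Real.log_nonneg hn'])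
      have hA : (n * divAt X ν s' - 3 * Real.log (1 + Real.log n)) / b =
        Y + c - 2 * Real.log (Real.log b) := by rw [hY]; ring
      rw [div_eq_iff hb0.ne'] at hA
      have hlog : 0 ≤ Real.log ((j : ℝ) + 1) := Real.log_nonneg (by simp)
      have hB : (y + c + 2 * Real.log ((j : ℝ) + 1)) * b ≤ n * divAt X ν s' := by
        -- Here 2 b ≤ 3 is used: this is the source of the constant 3 in the threshold.
        have h3 : 2 * b * Real.log (1 + Real.log n) ≤ 3 * Real.log (1 + Real.log n) :=
          mul_le_mul_of_nonneg_right (by linarith) hln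
        have h4 : (y + c + 2 * Real.log ((j : ℝ) + 1)) * b ≤
            (Y + c + 2 * (Real.log (1 + Real.log n) - Real.log (Real.log b))) * b :=
          mul_le_mul_of_nonneg_right (by linarith) hb0.le
        linarith
      have hC : 0 ≤ divAt X ν s' := by
        by_contra hneg
        have : (n : ℝ) * divAt X ν s' ≤ 0 :=
          mul_nonpos_of_nonneg_of_nonpos (by linarith) (by linarith)
        have h5 : (Y + c - 2 * Real.log (Real.log b)) * b > 0 := by
          apply mul_pos _ hb0; linarith
        linarith
      simp only [v]
      rw [div_le_iff₀ hbj]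
      -- Replacing n by b ^ j costs a factor b, which the division by b in Y absorbs.
      have h6 : (n : ℝ) * divAt X ν s' ≤ b ^ (j + 1) * divAt X ν s' :=
        mul_le_mul_of_nonneg_right hj2 hC
      rw [pow_succ] at h6
      have h7 : (y + c + 2 * Real.log ((j : ℝ) + 1)) * b ≤ (divAt X ν s' * b ^ j) * b := by
        linarith
      exact le_of_mul_le_mul_right h7 hb0
    have hwm : Measurable fun s => ENNReal.ofReal (Real.exp
        (n * (s * deriv (cgf X ν) s' - cgf X ν s))) := by
      have := measurable_cgf (ν := ν) hX
      fun_prop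
    have hkey : ENNReal.ofReal ((1 - l) * (Real.exp (l * Y) - 1)) ≤
        ENNReal.ofReal (l * p j) * ∫⁻ s, ENNReal.ofReal (Real.exp
          (n * (s * deriv (cgf X ν) s' - cgf X ν s))) ∂(κ j β) := by
      rw [lintegral_map hwm (hs β j)]
      refine ofReal_le_lintegral_expMeasure hl0 hl1 hY0.le (hp j) (hwm.comp (hs β j)) ?_
      intro y hy
      refine ENNReal.ofReal_le_ofReal ?_
      have h8 := hβ (v j y) (hlev y hy.2)
      have hv0 : 0 ≤ y + c + 2 * Real.log ((j : ℝ) + 1) := by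
        have : 0 ≤ Real.log ((j : ℝ) + 1) := Real.log_nonneg (by simp)
        linarith [hy.1]
      have h9 : y + c + 2 * Real.log ((j : ℝ) + 1) ≤
          n * (σ β (v j y) * deriv (cgf X ν) s' - cgf X ν (σ β (v j y))) := by
        calc y + c + 2 * Real.log ((j : ℝ) + 1) = b ^ j * v j y := by
              simp only [v]; field_simp
          _ ≤ n * v j y := mul_le_mul_of_nonneg_right hj1 (div_nonneg hv0 hbj.le)
          _ ≤ _ := mul_le_mul_of_nonneg_left h8 (by linarith)
      refine le_trans (le_of_eq ?_) (Real.exp_le_exp.mpr h9)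
      rw [Real.exp_add, Real.exp_add, hc, Real.exp_log (by positivity),
        show 2 * Real.log ((j : ℝ) + 1) = Real.log (((j : ℝ) + 1) ^ 2) by simp [Real.log_pow],
        Real.exp_log (by positivity)]
      simp only [p]
      field_simp
    have hterm : ENNReal.ofReal ((1 - l) * (Real.exp (l * Y) - 1)) ≤
        ∑' j, ENNReal.ofReal (l * p j) * (∫⁻ s, ENNReal.ofReal (Real.exp
          (n * (s * deriv (cgf X ν) s' - cgf X ν s))) ∂(κ j true) +
          ∫⁻ s, ENNReal.ofReal (Real.exp
          (n * (s * deriv (cgf X ν) s' - cgf X ν s))) ∂(κ j false)) := by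
      refine le_trans (hkey.trans ?_) (ENNReal.le_tsum j)
      refine mul_le_mul_right ?_ _
      cases β
      · exact le_add_self
      · exact le_self_add
    refine le_trans (le_of_eq ?_) (add_le_add_right hterm _)
    have : 1 ≤ Real.exp (l * Y) := Real.one_le_exp (by positivity)
    rw [← ENNReal.ofReal_add hl1'.le (mul_nonneg hl1'.le (by linarith))]
    congr 1
    ring

end Mixture

end PrePEx

/-! ### Attainable means and Kullback-Leibler divergences -/

namespace PrePEx

section MeanParametrization

open Filter Topology

variable {E : Type*} [MeasurableSpace E] {ν : Measure E} {X : E → ℝ}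

/-- If `X` exceeds `m` with positive probability, its exponential moments about `m` diverge. -/
lemma exists_one_le_lintegral_exp [IsFiniteMeasure ν] (hX : Measurable X) {m : ℝ}
    (hm : 0 < ν {x | m < X x}) :
    ∃ B : ℝ, 0 ≤ B ∧ ∀ s, B ≤ s → 1 ≤ ∫⁻ x, ENNReal.ofReal (Real.exp (s * (X x - m))) ∂ν := by
  obtain ⟨k, hk⟩ : ∃ k : ℕ, 0 < ν {x | m + 1 / ((k : ℝ) + 1) ≤ X x} := by
    by_contra! hcon
    refine hm.ne' (measure_mono_null ?_ (measure_iUnion_null fun k => nonpos_iff_eq_zero.mp (hcon k)))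
    intro x hx
    obtain ⟨k, hk⟩ := exists_nat_one_div_lt (show 0 < X x - m by simpa using hx)
    exact Set.mem_iUnion.mpr ⟨k, by simp only [Set.mem_ofPred_eq]; linarith⟩
  set ε : ℝ := 1 / ((k : ℝ) + 1) with hε
  have hε0 : 0 < ε := by positivity
  set p := ν.real {x | m + ε ≤ X x} with hp
  have hp0 : 0 < p := ENNReal.toReal_pos hk.ne' (measure_ne_top _ _)
  have hset : MeasurableSet {x | m + ε ≤ X x} := measurableSet_le measurable_const hX
  refine ⟨max 0 (-Real.log p / ε), le_max_left _ _, fun s hs => ?_⟩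
  have hs0 : 0 ≤ s := (le_max_left _ _).trans hs
  have hs1 : -Real.log p ≤ s * ε := by
    rw [← div_le_iff₀ hε0]; exact (le_max_right _ _).trans hs
  have h1 : ENNReal.ofReal (Real.exp (s * ε)) * ν {x | m + ε ≤ X x} ≤
      ∫⁻ x, ENNReal.ofReal (Real.exp (s * (X x - m))) ∂ν := by
    rw [← setLIntegral_const]
    refine le_trans (setLIntegral_mono' hset fun x hx => ?_) (setLIntegral_le_lintegral _ _)
    refine ENNReal.ofReal_le_ofReal (Real.exp_le_exp.mpr ?_)
    have hx' : m + ε ≤ X x := hx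
    exact mul_le_mul_of_nonneg_left (by linarith) hs0
  refine le_trans ?_ h1
  rw [← ofReal_measureReal (measure_ne_top _ _), ← ENNReal.ofReal_mul (Real.exp_pos _).le,
    ENNReal.one_le_ofReal]
  calc (1 : ℝ) = Real.exp (-Real.log p) * p := by
        rw [Real.exp_neg, Real.exp_log hp0]; field_simp
    _ ≤ _ := mul_le_mul_of_nonneg_right (Real.exp_le_exp.mpr hs1) hp0.le

/-- Every value strictly inside the convex hull of the support of `X` is the mean of a member of
the regular exponential family generated by `X`. -/
lemma exists_deriv_cgf_eq [IsProbabilityMeasure ν] (hX : Measurable X)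
    (hΘ : IsOpen (integrableExpSet X ν)) {m : ℝ} (hup : 0 < ν {x | m < X x})
    (hlo : 0 < ν {x | X x < m}) :
    ∃ s ∈ integrableExpSet X ν, deriv (cgf X ν) s = m := by
  set F : ℝ → ℝ≥0∞ := fun s => ∫⁻ x, ENNReal.ofReal (Real.exp (s * (X x - m))) ∂ν with hF
  -- `F` may be infinite, so continuity is not available; Fatou's lemma gives enough to minimise it
  -- on a compact interval.
  have hlsc : LowerSemicontinuous F := by
    rw [lowerSemicontinuous_iff_le_liminf]
    intro s
    refine le_trans (le_of_eq ?_) (lintegral_liminf_le fun s => by fun_prop)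
    refine lintegral_congr fun x => ?_
    refine (Tendsto.liminf_eq ?_).symm
    exact (ENNReal.continuous_ofReal.comp
      (by fun_prop : Continuous fun s => Real.exp (s * (X x - m)))).tendsto s
  have hF0 : F 0 = 1 := by simp [hF]
  obtain ⟨B₁, hB₁0, hB₁⟩ := exists_one_le_lintegral_exp hX hup
  obtain ⟨B₂, hB₂0, hB₂⟩ := exists_one_le_lintegral_exp (X := fun x => -X x) (m := -m) hX.neg
    (by simpa using hlo)
  obtain ⟨a, ha, hmin⟩ := (hlsc.lowerSemicontinuousOn (Set.Icc (-B₂) B₁)).exists_isMinOn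
    ⟨0, by constructor <;> linarith⟩ isCompact_Icc
  have hglob : ∀ s, F a ≤ F s := by
    intro s
    have ha1 : F a ≤ 1 := hF0 ▸ hmin (show (0 : ℝ) ∈ Set.Icc (-B₂) B₁ by constructor <;> linarith)
    rcases le_total B₁ s with h | h
    · exact ha1.trans (hB₁ s h)
    rcases le_total B₂ (-s) with h' | h'
    · refine ha1.trans ((hB₂ (-s) h').trans (le_of_eq ?_))
      refine lintegral_congr fun x => ?_
      congr 2; ring
    · exact hmin ⟨by linarith, h⟩
  have hfin : F a < ∞ := (hglob 0).trans_lt (by simp [hF0])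
  have hfac : ∀ s x, Real.exp (s * (X x - m)) = Real.exp (-(s * m)) * Real.exp (s * X x) := by
    intro s x
    rw [← Real.exp_add]; congr 1; ring
  have haΘ : a ∈ integrableExpSet X ν := by
    have h1 : Integrable (fun x => Real.exp (a * (X x - m))) ν := by
      refine ⟨by fun_prop, ?_⟩
      rw [hasFiniteIntegral_iff_ofReal (Filter.Eventually.of_forall fun x => (Real.exp_pos _).le)]
      exact hfin
    have h2 := h1.const_mul (Real.exp (a * m))
    refine h2.congr (Filter.Eventually.of_forall fun x => ?_)
    simp only
    rw [← Real.exp_add]; congr 1; ring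
  refine ⟨a, haΘ, ?_⟩
  have hval : ∀ s ∈ integrableExpSet X ν,
      F s = ENNReal.ofReal (Real.exp (cgf X ν s - s * m)) := by
    intro s hs
    simp only [hF, hfac]
    rw [← ofReal_integral_eq_lintegral_ofReal (Integrable.const_mul hs _)
      (Filter.Eventually.of_forall fun x => by positivity), integral_const_mul]
    congr 1
    rw [sub_eq_neg_add, Real.exp_add, exp_cgf hs]
    rfl
  -- Openness of the domain makes the minimiser interior, so the derivative of φ(s) - s m vanishes
  -- there.
  have hloc : IsLocalMin (fun s => cgf X ν s - s * m) a := by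
    filter_upwards [hΘ.mem_nhds haΘ] with s hs
    have := hglob s
    rw [hval a haΘ, hval s hs, ENNReal.ofReal_le_ofReal_iff (Real.exp_pos _).le,
      Real.exp_le_exp] at this
    exact this
  have hd : HasDerivAt (fun s => cgf X ν s - s * m) (deriv (cgf X ν) a - 1 * m) a := by
    refine HasDerivAt.sub ?_ ((hasDerivAt_id a).mul_const m)
    exact (analyticAt_cgf (hΘ.interior_eq.symm ▸ haΘ)).differentiableAt.hasDerivAt
  have := hloc.hasDerivAt_eq_zero hd
  linarith

/-- The log-density of the tilted law is s X - φ(s), and X has mean φ'(s) under it. -/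
lemma integrable_llr_tilted_mul [IsProbabilityMeasure ν]
    {s : ℝ} (hs : s ∈ interior (integrableExpSet X ν)) :
    Integrable (llr (ν.tilted fun x => s * X x) ν) (ν.tilted fun x => s * X x) ∧
      ∫ x, llr (ν.tilted fun x => s * X x) ν x ∂(ν.tilted fun x => s * X x) = divAt X ν s := by
  have hint : Integrable (fun x => Real.exp (s * X x)) ν :=
    interior_subset (s := integrableExpSet X ν) hs
  have := isProbabilityMeasure_tilted hint
  have hllr : llr (ν.tilted fun x => s * X x) ν =ᵐ[ν.tilted fun x => s * X x]
      fun x => s * X x - cgf X ν s :=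
    (tilted_absolutelyContinuous _ _).ae_le (log_rnDeriv_tilted_left_self hint)
  have hXi : Integrable X (ν.tilted fun x => s * X x) := (memLp_tilted_mul hs 1).integrable le_rfl
  refine ⟨((hXi.const_mul s).sub (integrable_const _)).congr hllr.symm, ?_⟩
  rw [integral_congr_ae hllr, integral_sub (hXi.const_mul s) (integrable_const _),
    integral_const_mul, integral_tilted_mul_self hs]
  simp [divAt]

/-- The Kullback-Leibler divergence of a member of an exponential family from its base law. -/
lemma klDiv_tilted_eq [IsProbabilityMeasure ν]
    {s : ℝ} (hs : s ∈ interior (integrableExpSet X ν)) :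
    InformationTheory.klDiv (ν.tilted fun x => s * X x) ν = ENNReal.ofReal (divAt X ν s) := by
  have := isProbabilityMeasure_tilted (interior_subset (s := integrableExpSet X ν) hs)
  obtain ⟨hi, hint⟩ := integrable_llr_tilted_mul hs
  rw [InformationTheory.klDiv_of_ac_of_integrable (tilted_absolutelyContinuous _ _) hi, hint]
  simp

lemma divAt_nonneg [IsProbabilityMeasure ν] {s : ℝ}
    (hs : s ∈ interior (integrableExpSet X ν)) : 0 ≤ divAt X ν s := by
  have := isProbabilityMeasure_tilted (interior_subset (s := integrableExpSet X ν) hs)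
  obtain ⟨hi, hint⟩ := integrable_llr_tilted_mul hs
  have h := InformationTheory.integral_llr_add_sub_measure_univ_nonneg
    (tilted_absolutelyContinuous _ _) hi
  rw [hint] at h
  simpa using h

/-- Almost every point of the line lies strictly below the essential supremum of a law without
atoms. -/
lemma measure_setOf_Ioi_null (ρ : Measure ℝ) [NullSingletonClass ρ] : ρ {x | ρ (Set.Ioi x) = 0} = 0 := by
  refine measure_null_of_locally_null _ fun x hx => ?_
  -- Either a smaller point of the set gives a null open ray around x, or x is its least point and
  -- [x, ∞) is null for lack of an atom.
  by_cases hmin : ∃ y, ρ (Set.Ioi y) = 0 ∧ y < x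
  · obtain ⟨y, hy, hyx⟩ := hmin
    exact ⟨Set.Ioi y, mem_nhdsWithin_of_mem_nhds (Ioi_mem_nhds hyx), hy⟩
  · push Not at hmin
    refine ⟨Set.Ici x, ?_, ?_⟩
    · exact Filter.mem_of_superset self_mem_nhdsWithin fun y hy => hmin y hy
    · rw [measure_congr Ioi_ae_eq_Ici.symm]; exact hx

/-- Almost surely, a random variable without atoms is neither an essential maximum nor an
essential minimum of its law. -/
lemma ae_pos_measure_lt (hX : Measurable X) (hatom : ∀ c, ν {x | X x = c} = 0) :
    ∀ᵐ r ∂ν, 0 < ν {x | X r < X x} ∧ 0 < ν {x | X x < X r} := by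
  have key : ∀ Y : E → ℝ, Measurable Y → (∀ c, ν {x | Y x = c} = 0) →
      ∀ᵐ r ∂ν, 0 < ν {x | Y r < Y x} := by
    intro Y hY hY0
    have : NullSingletonClass (ν.map Y) :=
      ⟨fun c => by rw [Measure.map_apply hY (measurableSet_singleton c)]; exact hY0 c⟩
    have h := measure_setOf_Ioi_null (ν.map Y)
    have h' := ae_of_ae_map (f := Y) (p := fun x => ¬ ν.map Y (Set.Ioi x) = 0) hY.aemeasurable
      (by rw [ae_iff]; simpa using h)
    filter_upwards [h'] with r hr
    rw [Measure.map_apply hY measurableSet_Ioi] at hr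
    exact pos_iff_ne_zero.mpr hr
  filter_upwards [key X hX hatom, key (fun x => -X x) hX.neg
    (fun c => by simpa [neg_eq_iff_eq_neg] using hatom (-c))] with r h1 h2
  exact ⟨h1, by simpa using h2⟩

end MeanParametrization

end PrePEx

/-! ### Likelihood ratios under adaptive sampling -/

namespace PrePEx

section Martingale

variable {Ω : Type*} {mΩ : MeasurableSpace Ω} {P : Measure Ω} {L K : ℕ} {ℱ : Filtration ℕ mΩ}
  {ν : Fin K → Measure (EuclideanSpace ℝ (Fin L))} {A : ℕ → Ω → Fin K}
  {R : ℕ → Ω → EuclideanSpace ℝ (Fin L)}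

lemma IsBanditProcess.measurableSet_arm (hAR : IsBanditProcess P ℱ ν A R) (n : ℕ) (k : Fin K) :
    MeasurableSet[ℱ n] (A n ⁻¹' {k}) :=
  hAR.measurable_arm n (measurableSet_singleton k)

lemma IsBanditProcess.measurable_reward' (hAR : IsBanditProcess P ℱ ν A R) (n : ℕ) :
    Measurable (R n) :=
  (hAR.measurable_reward n).mono (ℱ.le _) le_rfl

/-- On an event of the past on which arm `k` is chosen, the reward has law `ν k`. -/
lemma IsBanditProcess.map_restrict [IsProbabilityMeasure P] [∀ k, IsProbabilityMeasure (ν k)]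
    (hAR : IsBanditProcess P ℱ ν A R) (n : ℕ) (k : Fin K) {S : Set Ω} (hS : MeasurableSet[ℱ n] S) :
    (P.restrict (S ∩ A n ⁻¹' {k})).map (R n) = P (S ∩ A n ⁻¹' {k}) • ν k := by
  have hS' : MeasurableSet[ℱ n] (S ∩ A n ⁻¹' {k}) :=
    MeasurableSet.inter hS (hAR.measurableSet_arm n k)
  have hR := hAR.measurable_reward' n
  ext B hB
  rw [Measure.map_apply hR hB, Measure.restrict_apply (hR hB), Measure.smul_apply, smul_eq_mul]
  have h1 := setIntegral_condExp (μ := P) (ℱ.le n) (f := (R n ⁻¹' B).indicator fun _ => (1 : ℝ))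
    ((integrable_const _).indicator (hR hB)) hS'
  have h2 : ∫ ω in S ∩ A n ⁻¹' {k}, (ν (A n ω)).real B ∂P =
      ∫ ω in S ∩ A n ⁻¹' {k}, (ν k).real B ∂P := by
    refine setIntegral_congr_fun (ℱ.le n _ hS') fun ω hω => ?_
    have : A n ω = k := hω.2
    simp only [this]
  rw [setIntegral_congr_ae (ℱ.le n _ hS') ((hAR.condLaw n B hB).mono fun ω h _ => h), h2,
    setIntegral_const, setIntegral_indicator (hR hB), setIntegral_const, smul_eq_mul, smul_eq_mul,
    mul_one, measureReal_def, measureReal_def, measureReal_def, ← ENNReal.toReal_mul,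
    ENNReal.toReal_eq_toReal_iff' (by finiteness) (by finiteness), Set.inter_comm _ (R n ⁻¹' B)] at h1
  exact h1.symm

/-- One martingale step: by monotone approximation G reduces to indicators of past events, where
`map_restrict` gives the law of the reward. -/
lemma IsBanditProcess.setLIntegral_mul [IsProbabilityMeasure P]
    [∀ k, IsProbabilityMeasure (ν k)]
    (hAR : IsBanditProcess P ℱ ν A R) (n : ℕ) (k : Fin K)
    {g : EuclideanSpace ℝ (Fin L) → ℝ≥0∞} (hg : Measurable g) (hg1 : ∫⁻ r, g r ∂(ν k) = 1)
    {G : Ω → ℝ≥0∞} (hG : Measurable[ℱ n] G) :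
    ∫⁻ ω in A n ⁻¹' {k}, G ω * g (R n ω) ∂P = ∫⁻ ω in A n ⁻¹' {k}, G ω ∂P := by
  have hR := hAR.measurable_reward' n
  have hgR : Measurable fun ω => g (R n ω) := hg.comp hR
  refine Measurable.ennreal_induction (mα := ℱ n)
    (motive := fun G => ∫⁻ ω in A n ⁻¹' {k}, G ω * g (R n ω) ∂P = ∫⁻ ω in A n ⁻¹' {k}, G ω ∂P)
    ?_ ?_ ?_ hG
  · intro c S hS
    have hS' := ℱ.le n _ hS
    have h1 : ∀ ω, S.indicator (fun _ => c) ω * g (R n ω) =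
        S.indicator (fun ω => c * g (R n ω)) ω := by
      intro ω; by_cases h : ω ∈ S <;> simp [h]
    simp_rw [h1]
    rw [lintegral_indicator hS', lintegral_indicator hS', Measure.restrict_restrict hS',
      lintegral_const_mul _ hgR, setLIntegral_const, ← lintegral_map hg hR,
      hAR.map_restrict n k hS, lintegral_smul_measure, hg1, smul_eq_mul, mul_one]
  · intro f f' _ hf hf' h h'
    have hf0 : Measurable f := hf.mono (ℱ.le n) le_rfl
    have hfg : Measurable fun ω => f ω * g (R n ω) := hf0.mul hgR
    simp only [Pi.add_apply, add_mul]
    rw [lintegral_add_left hfg, lintegral_add_left hf0, h, h']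
  · intro f hf hmono h
    have hf0 : ∀ i, Measurable (f i) := fun i => (hf i).mono (ℱ.le n) le_rfl
    have hfg : ∀ i, Measurable fun ω => f i ω * g (R n ω) := fun i => (hf0 i).mul hgR
    simp only [ENNReal.iSup_mul]
    rw [lintegral_iSup hfg
      (fun i j hij ω => mul_le_mul_left (hmono hij ω) _), lintegral_iSup hf0 hmono]
    simp only [h]

/-- Products of likelihood ratios of the observed rewards have expectation one. -/
lemma IsBanditProcess.lintegral_prod_eq_one [IsProbabilityMeasure P]
    [∀ k, IsProbabilityMeasure (ν k)] (hAR : IsBanditProcess P ℱ ν A R)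
    {g : Fin K → EuclideanSpace ℝ (Fin L) → ℝ≥0∞} (hg : ∀ k, Measurable (g k))
    (hg1 : ∀ k, ∫⁻ r, g k r ∂(ν k) = 1) (t : ℕ) :
    ∫⁻ ω, ∏ i ∈ Finset.range t, g (A i ω) (R i ω) ∂P = 1 := by
  induction t with
  | zero => simp
  | succ n ih =>
    have hG : Measurable[ℱ n] fun ω => ∏ i ∈ Finset.range n, g (A i ω) (R i ω) := by
      refine Finset.measurable_fun_prod _ fun i hi => ?_
      have hin : i + 1 ≤ n := Finset.mem_range.mp hi
      have hA : Measurable[ℱ n] (A i) :=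
        (hAR.measurable_arm i).mono (ℱ.mono (by omega)) le_rfl
      have hR : Measurable[ℱ n] (R i) := (hAR.measurable_reward i).mono (ℱ.mono hin) le_rfl
      have hun : Measurable fun p : Fin K × EuclideanSpace ℝ (Fin L) => g p.1 p.2 :=
        measurable_from_prod_countable_right hg
      exact hun.comp (hA.prodMk hR)
    have hsplit : ∀ f : Ω → ℝ≥0∞, ∫⁻ ω, f ω ∂P = ∑ k, ∫⁻ ω in A n ⁻¹' {k}, f ω ∂P := by
      intro f
      have hU : ⋃ k, A n ⁻¹' {k} = Set.univ := by ext ω; simp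
      rw [← tsum_fintype (L := .unconditional _), ← lintegral_iUnion
        (fun k => ℱ.le n _ (hAR.measurableSet_arm n k))
        (fun i j hij => Disjoint.preimage _ (by simpa using hij)), hU, setLIntegral_univ]
    rw [← ih, hsplit, hsplit (fun ω => ∏ i ∈ Finset.range n, g (A i ω) (R i ω))]
    refine Finset.sum_congr rfl fun k _ => ?_
    rw [← hAR.setLIntegral_mul n k (hg k) (hg1 k) hG]
    refine setLIntegral_congr_fun (ℱ.le n _ (hAR.measurableSet_arm n k)) fun ω hω => ?_
    have : A n ω = k := hω
    simp only [Finset.prod_range_succ, this]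

/-- A property that holds almost surely under the law of each arm holds almost surely for the
observed rewards. -/
lemma IsBanditProcess.ae_reward [IsProbabilityMeasure P] [∀ k, IsProbabilityMeasure (ν k)]
    (hAR : IsBanditProcess P ℱ ν A R) {p : Fin K → EuclideanSpace ℝ (Fin L) → Prop}
    (hp : ∀ k, ∀ᵐ r ∂(ν k), p k r) : ∀ᵐ ω ∂P, ∀ n, p (A n ω) (R n ω) := by
  rw [ae_all_iff]
  intro n
  have h : ∀ k, ∀ᵐ ω ∂P, A n ω = k → p k (R n ω) := by
    intro k
    have hm := hAR.map_restrict n k MeasurableSet.univ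
    rw [Set.univ_inter] at hm
    have h1 : ∀ᵐ r ∂((P.restrict (A n ⁻¹' {k})).map (R n)), p k r := by
      rw [hm]
      exact Measure.smul_absolutelyContinuous.ae_le (hp k)
    have h2 := ae_of_ae_map (hAR.measurable_reward' n).aemeasurable h1
    rwa [ae_restrict_iff' (ℱ.le n _ (hAR.measurableSet_arm n k))] at h2
  filter_upwards [ae_all_iff.mpr h] with ω hω
  exact hω _ rfl

end Martingale

end PrePEx

/-! ### Scalarisation of the vector family -/

namespace PrePEx

section Family

variable {L : ℕ} {h : EuclideanSpace ℝ (Fin L) → ℝ≥0} {η z : EuclideanSpace ℝ (Fin L)}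

lemma IsRegularExpFamily.isProbabilityMeasure_expLaw (hh : IsRegularExpFamily h)
    (hη : η ∈ naturalSpace h) : IsProbabilityMeasure (expLaw h η) := by
  have : NeZero (refMeasure h) := ⟨hh.ne_zero⟩
  exact isProbabilityMeasure_tilted hη

/-- Tilts compose, so the line through η in direction z is the exponential family of ⟪z, ·⟫ over the
law at η. -/
lemma expLaw_add_smul (hη : η ∈ naturalSpace h) (s : ℝ) :
    expLaw h (η + s • z) = (expLaw h η).tilted fun x => s * ⟪z, x⟫ := by
  rw [expLaw, expLaw, tilted_tilted hη]
  congr 1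
  ext x
  simp [inner_add_left, inner_smul_left]

lemma integrableExpSet_expLaw (hη : η ∈ naturalSpace h) :
    integrableExpSet (fun x => ⟪z, x⟫) (expLaw h η) = {s | η + s • z ∈ naturalSpace h} := by
  ext s
  simp only [integrableExpSet, Set.mem_ofPred_eq, expLaw, naturalSpace]
  rw [integrable_tilted_iff hη]
  refine integrable_congr (Filter.Eventually.of_forall fun x => ?_)
  simp [inner_add_left, inner_smul_left, Real.exp_add]

lemma IsRegularExpFamily.isOpen_integrableExpSet (hh : IsRegularExpFamily h)
    (hη : η ∈ naturalSpace h) :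
    IsOpen (integrableExpSet (fun x => ⟪z, x⟫) (expLaw h η)) := by
  rw [integrableExpSet_expLaw hη]
  exact hh.isOpen_naturalSpace.preimage (by fun_prop : Continuous fun s : ℝ => η + s • z)

lemma volume_hyperplane_eq_zero (hz : z ≠ 0) (c : ℝ) :
    volume {x : EuclideanSpace ℝ (Fin L) | ⟪z, x⟫ = c} = 0 := by
  by_cases hne : ∃ p : EuclideanSpace ℝ (Fin L), ⟪z, p⟫ = c
  · obtain ⟨p, hp⟩ := hne
    have hset : {x : EuclideanSpace ℝ (Fin L) | ⟪z, x⟫ = c} =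
        (AffineSubspace.mk' p (innerSL ℝ z).ker : Set (EuclideanSpace ℝ (Fin L))) := by
      ext x
      simp [AffineSubspace.mem_mk', inner_sub_right, sub_eq_zero, hp]
    rw [hset]
    refine Measure.addHaar_affineSubspace _ _ fun htop => hz ?_
    have h1 : (AffineSubspace.mk' p (innerSL ℝ z).ker).direction = ⊤ := by
      rw [htop, AffineSubspace.direction_top]
    rw [AffineSubspace.direction_mk'] at h1
    have h2 : z ∈ (innerSL ℝ z).ker := h1 ▸ Submodule.mem_top
    simpa using h2
  · push Not at hne
    simp [hne]

lemma expLaw_hyperplane_eq_zero (hz : z ≠ 0) (c : ℝ) :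
    expLaw h η {x | ⟪z, x⟫ = c} = 0 :=
  ((tilted_absolutelyContinuous _ _).trans (withDensity_absolutelyContinuous _ _))
    (volume_hyperplane_eq_zero hz c)

/-- Data processing: projecting onto z cannot increase the divergence of the vector laws, which is
`divAt`. Only this upper bound is needed. -/
lemma IsRegularExpFamily.scalarKL_le (hh : IsRegularExpFamily h) (hη : η ∈ naturalSpace h)
    {m : Fin L → ℝ} (hm : ∀ l, ∫ y, y l ∂(expLaw h η) = m l) {s : ℝ}
    (hs : s ∈ integrableExpSet (fun x => ⟪z, x⟫) (expLaw h η)) :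
    scalarKL h z (deriv (cgf (fun x => ⟪z, x⟫) (expLaw h η)) s) m ≤
      ENNReal.ofReal (divAt (fun x => ⟪z, x⟫) (expLaw h η) s) := by
  have := hh.isProbabilityMeasure_expLaw hη
  have hs' := (hh.isOpen_integrableExpSet (z := z) hη).interior_eq.symm ▸ hs
  rw [← klDiv_tilted_eq hs', ← expLaw_add_smul hη]
  have hprob : IsProbabilityMeasure (expLaw h (η + s • z)) :=
    hh.isProbabilityMeasure_expLaw (by rwa [integrableExpSet_expLaw hη] at hs)
  refine le_trans ?_ (InformationTheory.klDiv_map_le _ _ (g := fun y => ⟪z, y⟫) (by fun_prop))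
  refine iInf₂_le_of_le η s (iInf₂_le_of_le ⟨hη, hm⟩ ⟨?_, ?_⟩ le_rfl)
  · rwa [integrableExpSet_expLaw hη] at hs
  · rw [expLaw_add_smul hη]
    exact integral_tilted_mul_self hs'

end Family

/-- Products of mixtures integrate to one if the mixed products do. -/
lemma lintegral_prod_mixture_eq_one {Ω ι : Type*} [Fintype ι] [MeasurableSpace Ω] {P : Measure Ω}
    [IsProbabilityMeasure P] {π : ι → Measure ℝ} [∀ k, IsProbabilityMeasure (π k)]
    {f : ι → Ω → ℝ → ℝ≥0∞} (hf : ∀ k, Measurable (Function.uncurry (f k)))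
    (h : ∀ᵐ s ∂(Measure.pi π), ∫⁻ ω, ∏ k, f k ω (s k) ∂P = 1) :
    ∫⁻ ω, ∏ k, ∫⁻ s, f k ω s ∂(π k) ∂P = 1 := by
  have hfω : ∀ k ω, Measurable (f k ω) := fun k ω => (hf k).comp measurable_prodMk_left
  -- Coordinates are independent under the product measure, so the product of integrals becomes one
  -- integral and Tonelli applies.
  have h1 : ∀ ω, ∏ k, ∫⁻ s, f k ω s ∂(π k) = ∫⁻ s, ∏ k, f k ω (s k) ∂(Measure.pi π) := by
    intro ω
    have h2 := lintegral_prod_eq_prod_lintegral_of_indepFun Finset.univ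
      (fun k (s : ι → ℝ) => f k ω (s k)) (iIndepFun_pi (μ := π) fun k => (hfω k ω).aemeasurable)
      (fun k => (hfω k ω).comp (measurable_pi_apply k))
    rw [h2]
    refine Finset.prod_congr rfl fun k _ => ?_
    exact ((measurePreserving_eval π k).lintegral_comp (hfω k ω)).symm
  simp_rw [h1]
  rw [lintegral_lintegral_swap, lintegral_congr_ae h]
  · simp
  · refine Measurable.aemeasurable (Finset.measurable_fun_prod _ fun k _ => ?_)
    exact (hf k).comp (measurable_fst.prodMk ((measurable_pi_apply k).comp measurable_snd))

/-! ### Empirical means of the scalarised rewards -/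

section Sampling

variable {Ω : Type*} {mΩ : MeasurableSpace Ω} {P : Measure Ω} {L K : ℕ} {ℱ : Filtration ℕ mΩ}
  {ν : Fin K → Measure (EuclideanSpace ℝ (Fin L))} {A : ℕ → Ω → Fin K}
  {R : ℕ → Ω → EuclideanSpace ℝ (Fin L)}

lemma pulls_mul_scalarize_empMean (z : EuclideanSpace ℝ (Fin L)) (t : ℕ) (ω : Ω) (k : Fin K) :
    pulls A t ω k * scalarize z (empMean A R t ω) k =
      ∑ n ∈ (Finset.range t).filter (fun n => A n ω = k), ⟪z, R n ω⟫ := by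
  have hinner : ∀ n, ⟪z, R n ω⟫ = ∑ l, z l * R n ω l := fun n => by
    simp [PiLp.inner_apply, mul_comm]
  simp only [hinner, scalarize, empMean]
  rw [Finset.sum_comm, Finset.mul_sum]
  refine Finset.sum_congr rfl fun l _ => ?_
  rw [← Finset.mul_sum]
  rcases eq_or_ne (pulls A t ω k) 0 with h0 | h0
  · rw [h0]
    have : (Finset.range t).filter (fun n => A n ω = k) = ∅ := Finset.card_eq_zero.mp h0
    simp [this]
  · have : (pulls A t ω k : ℝ) ≠ 0 := by exact_mod_cast h0
    field_simp

lemma IsBanditProcess.measurable_pulls (hAR : IsBanditProcess P ℱ ν A R) (t : ℕ) (k : Fin K) :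
    Measurable fun ω => (pulls A t ω k : ℝ) := by
  simp only [pulls, Finset.card_filter, Nat.cast_sum, Nat.cast_ite, Nat.cast_one, Nat.cast_zero]
  refine Finset.measurable_fun_sum _ fun n _ => ?_
  exact Measurable.ite (ℱ.le n _ (hAR.measurableSet_arm n k)) measurable_const measurable_const

lemma IsBanditProcess.measurable_scalarize_empMean (hAR : IsBanditProcess P ℱ ν A R)
    (z : EuclideanSpace ℝ (Fin L)) (t : ℕ) (k : Fin K) :
    Measurable fun ω => scalarize z (empMean A R t ω) k := by
  simp only [scalarize, empMean, Finset.sum_filter]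
  refine Finset.measurable_fun_sum _ fun l _ => Measurable.const_mul (Measurable.div ?_
    (hAR.measurable_pulls t k)) _
  refine Finset.measurable_fun_sum _ fun n _ => ?_
  refine Measurable.ite (ℱ.le n _ (hAR.measurableSet_arm n k)) ?_ measurable_const
  have := hAR.measurable_reward' n
  fun_prop

/-- The likelihood ratio of the observed rewards, arm by arm. -/
lemma prod_range_likelihood (z : EuclideanSpace ℝ (Fin L)) (φ : Fin K → ℝ) (s : Fin K → ℝ)
    (t : ℕ) (ω : Ω) :
    ∏ i ∈ Finset.range t, ENNReal.ofReal (Real.exp (s (A i ω) * ⟪z, R i ω⟫ - φ (A i ω))) =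
      ∏ k, ENNReal.ofReal (Real.exp
        (pulls A t ω k * (s k * scalarize z (empMean A R t ω) k - φ k))) := by
  rw [← Finset.prod_fiberwise (Finset.range t) (fun i => A i ω)]
  refine Finset.prod_congr rfl fun k _ => ?_
  rw [mul_sub, mul_left_comm, pulls_mul_scalarize_empMean, Finset.mul_sum, pulls,
    ← nsmul_eq_mul, ← Finset.sum_const, ← Finset.sum_sub_distrib, Real.exp_sum,
    ENNReal.ofReal_prod_of_nonneg fun i _ => (Real.exp_pos _).le]
  refine Finset.prod_congr rfl fun i hi => ?_
  rw [(Finset.mem_filter.mp hi).2]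

/-- The likelihood ratio of a member of the exponential family with respect to the base law
integrates to one. -/
lemma lintegral_likelihood_eq_one {E : Type*} [MeasurableSpace E] {μ : Measure E}
    [IsProbabilityMeasure μ] {X : E → ℝ} {s : ℝ} (hs : s ∈ integrableExpSet X μ) :
    ∫⁻ x, ENNReal.ofReal (Real.exp (s * X x - cgf X μ s)) ∂μ = 1 := by
  have h1 : ∀ x, Real.exp (s * X x - cgf X μ s) = Real.exp (s * X x) * (mgf X μ s)⁻¹ := by
    intro x
    rw [Real.exp_sub, exp_cgf hs, div_eq_mul_inv]
  simp_rw [h1]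
  rw [← ofReal_integral_eq_lintegral_ofReal (Integrable.mul_const hs _)
    (Filter.Eventually.of_forall fun x => mul_nonneg (Real.exp_pos _).le
      (inv_nonneg.mpr mgf_nonneg)), integral_mul_const]
  change ENNReal.ofReal (mgf X μ s * (mgf X μ s)⁻¹) = 1
  rw [mul_inv_cancel₀ (mgf_pos hs).ne', ENNReal.ofReal_one]

/-- Almost surely, the empirical mean of every sampled arm is the mean of a member of its
scalarised exponential family. -/
lemma IsBanditProcess.ae_exists_deriv_cgf_eq [IsProbabilityMeasure P]
    [∀ k, IsProbabilityMeasure (ν k)] (hAR : IsBanditProcess P ℱ ν A R)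
    (z : EuclideanSpace ℝ (Fin L)) (hatom : ∀ k c, ν k {x | ⟪z, x⟫ = c} = 0)
    (hΘ : ∀ k, IsOpen (integrableExpSet (fun x => ⟪z, x⟫) (ν k))) (t : ℕ) :
    ∀ᵐ ω ∂P, ∀ k, pulls A t ω k ≠ 0 →
      ∃ s ∈ integrableExpSet (fun x => ⟪z, x⟫) (ν k),
        deriv (cgf (fun x => ⟪z, x⟫) (ν k)) s = scalarize z (empMean A R t ω) k := by
  have hX : Measurable fun x : EuclideanSpace ℝ (Fin L) => ⟪z, x⟫ := by fun_prop
  filter_upwards [hAR.ae_reward fun k => ae_pos_measure_lt hX (hatom k)] with ω hω k hk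
  set S := (Finset.range t).filter fun n => A n ω = k with hS
  have hcard : (S.card : ℝ) * scalarize z (empMean A R t ω) k = ∑ n ∈ S, ⟪z, R n ω⟫ :=
    pulls_mul_scalarize_empMean z t ω k
  have hne : S.Nonempty := Finset.card_ne_zero.mp hk
  have hconst : ∑ n ∈ S, scalarize z (empMean A R t ω) k = ∑ n ∈ S, ⟪z, R n ω⟫ := by
    rw [← hcard, Finset.sum_const, nsmul_eq_mul]
  have hAk : ∀ n ∈ S, A n ω = k := fun n hn => (Finset.mem_filter.mp hn).2
  refine exists_deriv_cgf_eq hX (hΘ k) ?_ ?_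
  -- Some reward is at least the average and lies strictly below the essential supremum; the lower
  -- side is symmetric.
  · obtain ⟨n, hn, hle⟩ := Finset.exists_le_of_sum_le hne hconst.le
    have := (hω n).1
    rw [hAk n hn] at this
    exact this.trans_le (measure_mono fun x hx => hle.trans_lt hx)
  · obtain ⟨n, hn, hle⟩ := Finset.exists_le_of_sum_le hne hconst.ge
    have := (hω n).2
    rw [hAk n hn] at this
    exact this.trans_le (measure_mono fun x hx => lt_of_lt_of_le hx hle)

end Sampling

/-- In positive dimension {0} has empty interior. -/
lemma IsOrderingCone.exists_ne_zero {L : ℕ} (hL : 0 < L) {C : Set (EuclideanSpace ℝ (Fin L))}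
    (hC : IsOrderingCone C) : ∃ z ∈ C, z ≠ 0 := by
  by_contra! hcon
  have : Nonempty (Fin L) := ⟨⟨0, hL⟩⟩
  obtain ⟨x, hx⟩ := hC.solid
  have hsub : interior C ⊆ interior {0} := interior_mono fun z hz => hcon z hz
  rw [interior_singleton] at hsub
  exact hsub hx

end PrePEx

/-! ### Calibration of the threshold -/

namespace PrePEx

/-- A total divergence above the threshold forces the calibrated divergences to be large. -/
lemma mul_hInv_le_sum_of_threshold_lt {K : ℕ} {N : Fin K → ℕ} {D : Fin K → ℝ} {δ b : ℝ}
    (hb1 : 1 < b)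
    (hb : b * ((hInv (1 + Real.log (1 / δ) / K) +
      Real.log (2 * ∑' n : ℕ, 1 / ((n : ℝ) + 1) ^ 2)) / 2 - Real.log (Real.log b)) ≤
      hTilde (3 / 2) ((hInv (1 + Real.log (1 / δ) / K) +
      Real.log (2 * ∑' n : ℕ, 1 / ((n : ℝ) + 1) ^ 2)) / 2))
    (hlt : threshold N δ < ∑ k, N k * D k) :
    K * hInv (1 + Real.log (1 / δ) / K) ≤ ∑ k, max 0
      ((N k * D k - 3 * Real.log (1 + Real.log (N k))) / b
        - Real.log (2 * ∑' n : ℕ, 1 / ((n : ℝ) + 1) ^ 2) + 2 * Real.log (Real.log b)) := by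
  set c := Real.log (2 * ∑' n : ℕ, 1 / ((n : ℝ) + 1) ^ 2)
  set y := hInv (1 + Real.log (1 / δ) / K)
  have hb0 : 0 < b := by linarith
  have hle : ∑ k, ((N k * D k - 3 * Real.log (1 + Real.log (N k))) / b - c
      + 2 * Real.log (Real.log b)) ≤ ∑ k, max 0
      ((N k * D k - 3 * Real.log (1 + Real.log (N k))) / b - c + 2 * Real.log (Real.log b)) :=
    Finset.sum_le_sum fun k _ => le_max_right _ _
  refine le_trans ?_ hle
  rw [Finset.sum_add_distrib, Finset.sum_sub_distrib, ← Finset.sum_div, Finset.sum_sub_distrib]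
  simp only [Finset.sum_const, Finset.card_univ, Fintype.card_fin, nsmul_eq_mul]
  unfold threshold calT at hlt
  have hK : (0 : ℝ) ≤ K := Nat.cast_nonneg K
  have h1 := mul_le_mul_of_nonneg_left hb hK
  have h2 : b * (K * (y + c - 2 * Real.log (Real.log b))) ≤
      ∑ k, N k * D k - ∑ k, 3 * Real.log (1 + Real.log (N k)) := by
    linarith
  have h3 := (le_div_iff₀' hb0).mpr h2
  linarith

/-- The choice l = 1 - 1/y maximises (1 - l) e^{ly}, with value exp(y - log y - 1); the definition
of y turns its K-th power into 1/δ. -/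
lemma one_sub_inv_pow_mul_exp {K : ℕ} (hK : 0 < K) {δ : ℝ} (hδ0 : 0 < δ) (hδ1 : δ < 1) :
    let y := hInv (1 + Real.log (1 / δ) / K)
    (1 - (1 - 1 / y)) ^ K * Real.exp ((1 - 1 / y) * (K * y)) = 1 / δ := by
  intro y
  have hK0 : (0 : ℝ) < K := by exact_mod_cast hK
  have hlog : 0 < Real.log (1 / δ) := Real.log_pos (by rw [lt_div_iff₀ hδ0]; linarith)
  have hx : 0 < Real.log (1 / δ) / K := by positivity
  obtain ⟨hy1, hy2⟩ := hInv_spec (show 1 ≤ 1 + Real.log (1 / δ) / K by linarith)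
  change 1 ≤ y at hy1
  change y - Real.log y = _ at hy2
  have hy0 : 0 < y := by linarith
  have h1 : (1 - (1 - 1 / y)) = Real.exp (-Real.log y) := by
    rw [Real.exp_neg, Real.exp_log hy0]; ring
  rw [h1, ← Real.exp_nat_mul, ← Real.exp_add,
    show K * -Real.log y + (1 - 1 / y) * (K * y) = K * ((y - Real.log y) - 1) by field_simp; ring,
    hy2, show (K : ℝ) * (1 + Real.log (1 / δ) / K - 1) = Real.log (1 / δ) by field_simp; ring,
    Real.exp_log (by positivity)]

end PrePEx

/-! ### The confidence bound -/

theorem lemma1 {Ω : Type*} [mΩ : MeasurableSpace Ω] (P : Measure Ω) [IsProbabilityMeasure P]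
    {L K : ℕ} (hL : 0 < L)
    (C : Set (EuclideanSpace ℝ (Fin L))) (hC : PrePEx.IsOrderingCone C)
    (h : Fin K → EuclideanSpace ℝ (Fin L) → ℝ≥0)
    (hh : ∀ k, PrePEx.IsRegularExpFamily (h k))
    (Mmin Mmax : ℝ) (M : Matrix (Fin L) (Fin K) ℝ)
    (hM : M ∈ PrePEx.instanceClass h Mmin Mmax)
    (ν : Fin K → Measure (EuclideanSpace ℝ (Fin L)))
    (hν : ∀ k, PrePEx.IsMember (h k) (ν k) fun l => M l k)
    (ℱ : Filtration ℕ mΩ)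
    (A : ℕ → Ω → Fin K) (R : ℕ → Ω → EuclideanSpace ℝ (Fin L))
    (hAR : PrePEx.IsBanditProcess P ℱ ν A R)
    (δ : ℝ) (hδ0 : 0 < δ) (hδ1 : δ < 1) (t : ℕ) :
    P {ω | M ∉ PrePEx.confSet C h Mmin Mmax A R t δ ω} ≤ ENNReal.ofReal δ := by
  open PrePEx in
  obtain ⟨z, hzC, hz⟩ := hC.exists_ne_zero hL
  have hK : 0 < K := by
    obtain ⟨ω⟩ := nonempty_of_isProbabilityMeasure P
    exact (Nat.zero_le _).trans_lt (A 0 ω).isLt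
  choose η hη hνη hmean using hν
  have hprob : ∀ k, IsProbabilityMeasure (ν k) := fun k =>
    hνη k ▸ (hh k).isProbabilityMeasure_expLaw (hη k)
  set X : EuclideanSpace ℝ (Fin L) → ℝ := fun x => ⟪z, x⟫ with hXdef
  have hX : Measurable X := by fun_prop
  have hΘ : ∀ k, IsOpen (integrableExpSet X (ν k)) := fun k =>
    hνη k ▸ (hh k).isOpen_integrableExpSet (hη k)
  have hatom : ∀ k c, ν k {x | X x = c} = 0 := fun k c => by
    rw [hνη k]; exact expLaw_hyperplane_eq_zero hz c
  have hK0 : (0 : ℝ) < K := by exact_mod_cast hK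
  have hlog : 0 < Real.log (1 / δ) := Real.log_pos (by rw [lt_div_iff₀ hδ0]; linarith)
  have hx : 0 < Real.log (1 / δ) / K := by positivity
  have hexp := one_sub_inv_pow_mul_exp hK hδ0 hδ1
  have hy1 := one_lt_hInv (show 1 < 1 + Real.log (1 / δ) / K by linarith)
  obtain ⟨b, hb1, hb2, hb⟩ := exists_affine_le_hTilde ((hInv (1 + Real.log (1 / δ) / K) +
      Real.log (2 * ∑' n : ℕ, 1 / ((n : ℝ) + 1) ^ 2)) / 2)
  set y := hInv (1 + Real.log (1 / δ) / K)
  have hy0 : 0 < y := by linarith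
  set l := 1 - 1 / y with hl
  have hl0 : 0 < l := by
    rw [hl, sub_pos, div_lt_one hy0]; exact hy1
  have hl1 : l < 1 := by
    rw [hl]; have : 0 < 1 / y := by positivity
    linarith
  have hmix := fun k => exists_mixture (ν := ν k) hX (by simp) (hΘ k) hl0 hl1 hb1 hb2
  choose π hπ hπΘ hπle using hmix
  set f : Fin K → Ω → ℝ → ℝ≥0∞ := fun k ω s => ENNReal.ofReal (Real.exp
    (pulls A t ω k * (s * scalarize z (empMean A R t ω) k - cgf X (ν k) s))) with hf
  have hfm : ∀ k, Measurable (Function.uncurry (f k)) := by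
    intro k
    have h1 := hAR.measurable_pulls t k
    have h2 := hAR.measurable_scalarize_empMean z t k
    have h3 : Measurable (cgf X (ν k)) := measurable_cgf hX
    exact ((h1.comp measurable_fst).mul ((measurable_snd.mul (h2.comp measurable_fst)).sub
      (h3.comp measurable_snd))).exp.ennreal_ofReal
  have hone : ∫⁻ ω, ∏ k, ∫⁻ s, f k ω s ∂(π k) ∂P = 1 := by
    refine lintegral_prod_mixture_eq_one hfm ?_
    have hs : ∀ᵐ s ∂(Measure.pi π), ∀ k, s k ∈ integrableExpSet X (ν k) :=
      ae_all_iff.mpr fun k => (Measure.quasiMeasurePreserving_eval π k).ae (hπΘ k)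
    -- With one parameter per arm frozen, the integrand is a product of likelihood ratios over the
    -- rounds.
    filter_upwards [hs] with s hs
    have := hAR.lintegral_prod_eq_one
      (g := fun k x => ENNReal.ofReal (Real.exp (s k * X x - cgf X (ν k) (s k))))
      (fun k => by fun_prop) (fun k => lintegral_likelihood_eq_one (hs k)) t
    rw [← this]
    exact lintegral_congr fun ω =>
      (prod_range_likelihood z (fun k => cgf X (ν k) (s k)) s t ω).symm
  have hWm : Measurable fun ω => ∏ k, ∫⁻ s, f k ω s ∂(π k) :=
    Finset.measurable_fun_prod _ fun k _ => (hfm k).lintegral_prod_right'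
  have hbad : ∀ᵐ ω ∂P, M ∉ confSet C h Mmin Mmax A R t δ ω →
      ENNReal.ofReal (1 / δ) ≤ ∏ k, ∫⁻ s, f k ω s ∂(π k) := by
    filter_upwards [hAR.ae_exists_deriv_cgf_eq z hatom hΘ t] with ω hω hMω
    have hs : ∀ k, ∃ s ∈ integrableExpSet X (ν k), pulls A t ω k ≠ 0 →
        deriv (cgf X (ν k)) s = scalarize z (empMean A R t ω) k := by
      intro k
      by_cases hk : pulls A t ω k = 0
      · exact ⟨0, zero_mem_integrableExpSet, fun h => absurd hk h⟩
      · obtain ⟨s, hs, hs'⟩ := hω k hk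
        exact ⟨s, hs, fun _ => hs'⟩
    choose s hsΘ hsm using hs
    have hlt : threshold (pulls A t ω) δ < ∑ k, pulls A t ω k * divAt X (ν k) (s k) := by
      by_contra! hle
      refine hMω ⟨hM, (iInf₂_le z ⟨hzC, hz⟩).trans ?_⟩
      have hnn : ∀ k, 0 ≤ divAt X (ν k) (s k) := fun k =>
        divAt_nonneg ((hΘ k).interior_eq.symm ▸ hsΘ k)
      refine le_trans ?_ (ENNReal.ofReal_le_ofReal hle)
      rw [ENNReal.ofReal_sum_of_nonneg fun k _ => mul_nonneg (Nat.cast_nonneg _) (hnn k)]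
      refine Finset.sum_le_sum fun k _ => ?_
      rcases eq_or_ne (pulls A t ω k) 0 with hk | hk
      · simp [hk]
      · rw [ENNReal.ofReal_mul (Nat.cast_nonneg _), ENNReal.ofReal_natCast, ← hsm k hk]
        refine mul_le_mul_right ?_ _
        have h1 := hsΘ k
        rw [hνη k] at h1 ⊢
        exact (hh k).scalarKL_le (hη k) (fun l => by rw [← hνη k]; exact hmean k l) h1
    have hsum := mul_hInv_le_sum_of_threshold_lt hb1 hb hlt
    rw [← hexp]
    have hprod := Finset.prod_le_prod' fun k (_ : k ∈ Finset.univ) =>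
      hπle k (pulls A t ω k) (s k) (hsΘ k)
    have hl1' : 0 < 1 - l := by linarith
    rw [← ENNReal.ofReal_prod_of_nonneg fun k _ => by positivity, Finset.prod_mul_distrib,
      Finset.prod_const, Finset.card_univ, Fintype.card_fin, ← Real.exp_sum,
      ← Finset.mul_sum] at hprod
    refine le_trans (ENNReal.ofReal_le_ofReal ?_) (hprod.trans (le_of_eq ?_))
    · refine mul_le_mul_of_nonneg_left (Real.exp_le_exp.mpr ?_) (by positivity)
      exact mul_le_mul_of_nonneg_left hsum hl0.le
    · refine Finset.prod_congr rfl fun k _ => lintegral_congr fun u => ?_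
      simp only [hf]
      rcases eq_or_ne (pulls A t ω k) 0 with hk | hk
      · simp [hk]
      · rw [hsm k hk]
  calc P {ω | M ∉ confSet C h Mmin Mmax A R t δ ω}
      ≤ P {ω | ENNReal.ofReal (1 / δ) ≤ ∏ k, ∫⁻ s, f k ω s ∂(π k)} := measure_mono_ae hbad
    _ ≤ (∫⁻ ω, ∏ k, ∫⁻ s, f k ω s ∂(π k) ∂P) / ENNReal.ofReal (1 / δ) :=
        meas_ge_le_lintegral_div hWm.aemeasurable (by simpa using hδ0) ENNReal.ofReal_ne_top
    _ = ENNReal.ofReal δ := by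
        rw [hone, one_div, one_div, ENNReal.ofReal_inv_of_pos hδ0, inv_inv]
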